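/- All notions are $\mathsf{Pos}$-enriched: a category has partially ordered hom-sets with monotone composition, a functor is locally monotone, and (weak) limits are weighted. A morphism $m$ is an order-monomorphism if $ms\le mt$ implies $s\le t$, and an $\mathsf{so}$-morphism is one that is left orthogonal (in the enriched sense) to all order-monomorphisms. A category $\mathcal{E}$ is regular if it has finite limits, every morphism factors as an $\mathsf{so}$-morphism followed by an order-monomorphism, and $\mathsf{so}$-morphisms are stable under pullback; it is exact if moreover every congruence (a relation that is reflexive, transitive and an order-ideal) is the kernel congruence $f/f$ of some morphism $f$. An object $P$ of $\mathcal{E}$ is $\mathsf{so}$-projective if $\mathcal{E}(P,-)$ sends $\mathsf{so}$-morphisms to surjections. Let $\mathcal{C}$ be weakly lex, i.e. for every finite weight $W\colon\mathcal{I}\to\mathsf{Pos}$ and every $D\colon\mathcal{I}\to\mathcal{C}$ there are an object $L$ and a natural transformation $W\to\mathcal{C}(L,D-)$ such that all induced maps $\mathcal{C}(X,L)\to[\mathcal{I},\mathsf{Pos}](W,\mathcal{C}(X,D-))$ are surjective. The exact completion $\mathcal{C}_{\mathrm{ex}}$ has as objects the pseudocongruences $(X,R)$ in $\mathcal{C}$: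 parallel pairs $r_0,r_1\colon R\to X$ such that every pair $a_0\le a_1\colon A\to X$ factors through $(r_0,r_1)$, and such that for a weak pullback $d_0,d_1\colon R*R\to R$ with $r_1d_0=r_0d_1$ there is $\tau\colon R*R\to R$ with $r_0\tau=r_0d_0$ and $r_1\tau=r_1d_1$. A morphism $(X,R)\to(Y,S)$ is a class $[f]$ of morphisms $f\colon X\to Y$ for which some $\bar f\colon R\to S$ satisfies $s_i\bar f=fr_i$ for $i=0,1$. The hom-posets are the poset reflections of the preorder in which $f\preccurlyeq g$ iff there is $\Sigma\colon X\to S$ with $s_0\Sigma=f$ and $s_1\Sigma=g$. Let $\mathcal{E}$ be exact and let $F\colon\mathcal{C}\to\mathcal{E}$ be left covering: for every finite weight $W$, every diagram $D$ in $\mathcal{C}$ and every weak limit $\{W,D\}_w$, the canonical comparison $F\{W,D\}_w\to\{W,FD\}$ is an effective epimorphism (a coinserter of some pair). Let $\overline{F}\colon\mathcal{C}_{\mathrm{ex}}\to\mathcal{E}$ be its extension: $\overline{F}(X,R)$ is the coinserter $q_{(X,R)}\colon FX\to\overline{F}(X,R)$ of $(Fr_0,Fr_1)$, and $\overline{F}[f]$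 is the unique morphism with $\overline{F}[f]\,q_{(X,R)}=q_{(Y,S)}\,Ff$. Then: 1. If $F$ is fully order-faithful (all maps $\mathcal{C}(X,Y)\to\mathcal{E}(FX,FY)$ are isomorphisms of posets) and $FX$ is $\mathsf{so}$-projective for every $X\in\mathcal{C}$, then $\overline{F}$ is fully order-faithful. 2. If, in addition to the conditions in (1), for every $A\in\mathcal{E}$ there is an $\mathsf{so}$-morphism $FX\to A$ for some $X\in\mathcal{C}$, then $\overline{F}$ is an equivalence of $\mathsf{Pos}$-categories. -/

import Mathlib

open CategoryTheory CategoryTheory.Limits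

universe v u v₁ u₁ v₂ u₂ v₃ u₃

namespace PosCat

/-! ## Categories and functors enriched in posets -/

/-- Enrichment of a category in the cartesian monoidal category of posets: every hom-set is
partially ordered, and composition is monotone in both variables. -/
class PosEnriched (C : Type u) [Category.{v} C] where
  homOrder (X Y : C) : PartialOrder (X ⟶ Y)
  comp_le_comp {X Y Z : C} {f f' : X ⟶ Y} {g g' : Y ⟶ Z} :
    f ≤ f' → g ≤ g' → f ≫ g ≤ f' ≫ g'

attribute [reducible, instance] PosEnriched.homOrder

/-- The category of posets and monotone maps, with the pointwise order on maps. -/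
instance : PosEnriched PartOrd.{u} where
  homOrder X Y := PartialOrder.lift (fun f : X ⟶ Y => f.hom) (fun _ _ h => PartOrd.hom_ext h)
  comp_le_comp {_ _ _ _ f' g _} h k := fun x => (g.hom.monotone (h x)).trans (k (f'.hom x))

/-- Every ordinary category, with the discrete order on its hom-sets. -/
@[reducible] def discreteEnriched (C : Type u) [Category.{v} C] : PosEnriched C where
  homOrder X Y :=
    { le := fun f g => f = g
      le_refl := fun _ => rfl
      le_trans := fun _ _ _ h k => h.trans k
      le_antisymm := fun _ _ h _ => h }
  comp_le_comp h k := by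
    have h' := h
    have k' := k
    change _ = _ at h'
    change _ = _ at k'
    subst h' k'
    exact rfl

/-- Functors of poset-enriched categories: locally monotone functors. -/
structure PosFunctor (C : Type u₁) [Category.{v₁} C] [PosEnriched C]
    (D : Type u₂) [Category.{v₂} D] [PosEnriched D] extends C ⥤ D where
  monotone_map {X Y : C} {f g : X ⟶ Y} : f ≤ g → toFunctor.map f ≤ toFunctor.map g

/-- Composition of poset-enriched functors. -/
def PosFunctor.comp {C : Type u₁} [Category.{v₁} C] [PosEnriched C]
    {D : Type u₂} [Category.{v₂} D] [PosEnriched D]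
    {E : Type u₃} [Category.{v₃} E] [PosEnriched E]
    (F : PosFunctor C D) (G : PosFunctor D E) : PosFunctor C E where
  toFunctor := F.toFunctor ⋙ G.toFunctor
  monotone_map h := G.monotone_map (F.monotone_map h)

/-- `F` is fully order-faithful: every `C(X, Y) → D(F X, F Y)` is an isomorphism of posets. -/
structure PosFunctor.FullyOrderFaithful {C : Type u₁} [Category.{v₁} C] [PosEnriched C]
    {D : Type u₂} [Category.{v₂} D] [PosEnriched D] (F : PosFunctor C D) : Prop where
  full {X Y : C} (h : F.obj X ⟶ F.obj Y) : ∃ f : X ⟶ Y, F.map f = h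
  map_le_map_iff {X Y : C} (f g : X ⟶ Y) : F.map f ≤ F.map g ↔ f ≤ g

/-- `F` is an equivalence of poset-enriched categories: it has a poset-enriched pseudo-inverse.
(A natural isomorphism of poset-enriched functors is just an ordinary natural isomorphism.) -/
def PosFunctor.IsEquivalence {C : Type u₁} [Category.{v₁} C] [PosEnriched C]
    {D : Type u₂} [Category.{v₂} D] [PosEnriched D] (F : PosFunctor C D) : Prop :=
  ∃ G : PosFunctor D C,
    Nonempty (F.toFunctor ⋙ G.toFunctor ≅ 𝟭 C) ∧ Nonempty (G.toFunctor ⋙ F.toFunctor ≅ 𝟭 D)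

/-! ## Weighted limits and weak weighted limits -/

section Limits

variable {I : Type} [Category.{0} I] [PosEnriched I]
variable {C : Type u} [Category.{v} C] [PosEnriched C]

/-- A natural transformation `W ⟶ C(L, D -)` of poset-enriched functors. -/
@[ext]
structure WeightedCone (W : PosFunctor I PartOrd.{0}) (D : PosFunctor I C) (L : C) where
  app (i : I) (w : W.obj i) : L ⟶ D.obj i
  monotone_app (i : I) : Monotone (app i)
  naturality {i j : I} (α : i ⟶ j) (w : W.obj i) : app j ((W.map α).hom w) = app i w ≫ D.map α

namespace WeightedCone

variable {W : PosFunctor I PartOrd.{0}} {D : PosFunctor I C} {L : C}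

/-- The order of the hom-poset `[I, Pos](W, C(L, D -))`. -/
instance : LE (WeightedCone W D L) := ⟨fun c d => ∀ i w, c.app i w ≤ d.app i w⟩

/-- The map `C(A, L) → [I, Pos](W, C(A, D -))` induced by a cone with vertex `L`. -/
def precomp (c : WeightedCone W D L) {A : C} (t : A ⟶ L) : WeightedCone W D A where
  app i w := t ≫ c.app i w
  monotone_app i _ _ h := PosEnriched.comp_le_comp le_rfl (c.monotone_app i h)
  naturality α w := by rw [c.naturality, Category.assoc]

/-- The image of a cone under a poset-enriched functor. -/
def map {E : Type u₂} [Category.{v₂} E] [PosEnriched E] (c : WeightedCone W D L)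
    (F : PosFunctor C E) : WeightedCone W (D.comp F) (F.obj L) where
  app i w := F.map (c.app i w)
  monotone_app i _ _ h := F.monotone_map (c.monotone_app i h)
  naturality α w := by
    rw [c.naturality]
    exact F.map_comp _ _

/-- `c` is a weak limit of `D` weighted by `W`: each
`C(A, L) → [I, Pos](W, C(A, D -))` is surjective. -/
def IsWeakLimit (c : WeightedCone W D L) : Prop :=
  ∀ A : C, Function.Surjective (c.precomp (A := A))

/-- `c` is a limit of `D` weighted by `W`: each
`C(A, L) → [I, Pos](W, C(A, D -))` is an isomorphism of posets. -/
structure IsLimit (c : WeightedCone W D L) : Prop where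
  surjective (A : C) : Function.Surjective (c.precomp (A := A))
  le_of_precomp_le {A : C} (s t : A ⟶ L) : c.precomp s ≤ c.precomp t → s ≤ t

end WeightedCone

/-- Finite weights. -/
structure IsFiniteWeight (W : PosFunctor I PartOrd.{0}) : Prop where
  finite_objects : Finite (Quotient (isIsomorphicSetoid I))
  finite_hom (i j : I) : Finite (i ⟶ j)
  finite_values (i : I) : Finite (W.obj i)

end Limits

/-- Existence of all limits with finite weight. -/
class Lex (C : Type u) [Category.{v} C] [PosEnriched C] : Prop where
  exists_limit {I : Type} [Category.{0} I] [PosEnriched I] (W : PosFunctor I PartOrd.{0})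
    (hW : IsFiniteWeight W) (D : PosFunctor I C) :
    ∃ (L : C) (c : WeightedCone W D L), c.IsLimit

/-- Existence of all weak limits with finite weight. -/
class WeaklyLex (C : Type u) [Category.{v} C] [PosEnriched C] : Prop where
  exists_weakLimit {I : Type} [Category.{0} I] [PosEnriched I] (W : PosFunctor I PartOrd.{0})
    (hW : IsFiniteWeight W) (D : PosFunctor I C) :
    ∃ (L : C) (c : WeightedCone W D L), c.IsWeakLimit

/-! ## Classes of morphisms, special limits and colimits -/

section Morphisms

variable {C : Type u} [Category.{v} C] [PosEnriched C]

/-- Order-monomorphisms. -/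
def IsFF {X Y : C} (m : X ⟶ Y) : Prop :=
  ∀ ⦃Z : C⦄ (s t : Z ⟶ X), s ≫ m ≤ t ≫ m → s ≤ t

/-- `so`-morphisms: for every order-monomorphism `m : X ⟶ Y`, the map
`C(B, X) → C(A, X) ×_{C(A, Y)} C(B, Y)` is an isomorphism of posets. -/
structure IsSo {A B : C} (e : A ⟶ B) : Prop where
  exists_fill {X Y : C} (m : X ⟶ Y) (hm : IsFF m) (s : A ⟶ X) (t : B ⟶ Y) :
    s ≫ m = e ≫ t → ∃ d : B ⟶ X, e ≫ d = s ∧ d ≫ m = t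
  le_of_le {X Y : C} (m : X ⟶ Y) (hm : IsFF m) (d d' : B ⟶ X) :
    e ≫ d ≤ e ≫ d' → d ≫ m ≤ d' ≫ m → d ≤ d'

/-- A weak pullback square: `p₀ ≫ f = p₁ ≫ g`, weakly universal. -/
structure IsWeakPullback {P X Y Z : C} (p₀ : P ⟶ X) (p₁ : P ⟶ Y) (f : X ⟶ Z) (g : Y ⟶ Z) :
    Prop where
  w : p₀ ≫ f = p₁ ≫ g
  exists_lift {A : C} (a : A ⟶ X) (b : A ⟶ Y) :
    a ≫ f = b ≫ g → ∃ t : A ⟶ P, t ≫ p₀ = a ∧ t ≫ p₁ = b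

/-- A pullback square in the enriched sense: the legs are jointly order-monic. -/
structure IsPosPullback {P X Y Z : C} (p₀ : P ⟶ X) (p₁ : P ⟶ Y) (f : X ⟶ Z) (g : Y ⟶ Z) :
    Prop extends IsWeakPullback p₀ p₁ f g where
  le_of_le {A : C} (s t : A ⟶ P) : s ≫ p₀ ≤ t ≫ p₀ → s ≫ p₁ ≤ t ≫ p₁ → s ≤ t

/-- A comma square `c₀ ≫ f ≤ c₁ ≫ g`. -/
structure IsComma {P X Y Z : C} (c₀ : P ⟶ X) (c₁ : P ⟶ Y) (f : X ⟶ Z) (g : Y ⟶ Z) :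
    Prop where
  w : c₀ ≫ f ≤ c₁ ≫ g
  exists_lift {A : C} (a : A ⟶ X) (b : A ⟶ Y) :
    a ≫ f ≤ b ≫ g → ∃ t : A ⟶ P, t ≫ c₀ = a ∧ t ≫ c₁ = b
  le_of_le {A : C} (s t : A ⟶ P) : s ≫ c₀ ≤ t ≫ c₀ → s ≫ c₁ ≤ t ≫ c₁ → s ≤ t

/-- `q` is the coinserter of the ordered pair `(f, g)`. -/
structure IsCoinserter {X Y Q : C} (f g : X ⟶ Y) (q : Y ⟶ Q) : Prop where
  w : f ≫ q ≤ g ≫ q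
  exists_desc {Z : C} (h : Y ⟶ Z) : f ≫ h ≤ g ≫ h → ∃ t : Q ⟶ Z, q ≫ t = h
  le_of_le {Z : C} (s t : Q ⟶ Z) : q ≫ s ≤ q ≫ t → s ≤ t

/-- Effective epimorphisms: coinserters of some pair. -/
def IsEffectiveEpi {Y Q : C} (q : Y ⟶ Q) : Prop :=
  ∃ (X : C) (f g : X ⟶ Y), IsCoinserter f g q

/-- The generalized element `(x, y)` of `X × X` factors through the pair `(s₀, s₁)`. -/
def Related {S X A : C} (s₀ s₁ : S ⟶ X) (x y : A ⟶ X) : Prop :=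
  ∃ t : A ⟶ S, t ≫ s₀ = x ∧ t ≫ s₁ = y

/-- Congruences on `X`: relations (jointly order-monic pairs) which are reflexive, transitive
and order-ideals. -/
structure IsCongruence {S X : C} (s₀ s₁ : S ⟶ X) : Prop where
  le_of_le {A : C} (s t : A ⟶ S) : s ≫ s₀ ≤ t ≫ s₀ → s ≫ s₁ ≤ t ≫ s₁ → s ≤ t
  refl {A : C} (x : A ⟶ X) : Related s₀ s₁ x x
  trans {A : C} (x y z : A ⟶ X) : Related s₀ s₁ x y → Related s₀ s₁ y z → Related s₀ s₁ x z
  order_ideal {A : C} (x x' y y' : A ⟶ X) :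
    Related s₀ s₁ x y → x' ≤ x → y ≤ y' → Related s₀ s₁ x' y'

/-- `P` is `so`-projective: `C(P, -)` sends `so`-morphisms to surjections. -/
def SoProjective (P : C) : Prop :=
  ∀ ⦃A B : C⦄ (e : A ⟶ B), IsSo e → Function.Surjective (fun f : P ⟶ A => f ≫ e)

end Morphisms

/-- Regular poset-enriched categories. -/
class Regular (C : Type u) [Category.{v} C] [PosEnriched C] : Prop extends Lex C where
  exists_factorization {X Y : C} (f : X ⟶ Y) :
    ∃ (J : C) (e : X ⟶ J) (m : J ⟶ Y), IsSo e ∧ IsFF m ∧ e ≫ m = f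
  so_stable {P X Y Z : C} {p₀ : P ⟶ X} {p₁ : P ⟶ Y} {f : X ⟶ Z} {g : Y ⟶ Z} :
    IsPosPullback p₀ p₁ f g → IsSo g → IsSo p₀

/-- Exact poset-enriched categories: regular, and every congruence is effective, i.e. is the
kernel congruence of some morphism. -/
class Exact (C : Type u) [Category.{v} C] [PosEnriched C] : Prop extends Regular C where
  effective {S X : C} {s₀ s₁ : S ⟶ X} :
    IsCongruence s₀ s₁ → ∃ (Y : C) (f : X ⟶ Y), IsComma s₀ s₁ f f

/-- `F` is left covering: for every finite weight, the canonical comparison from the image of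
any weak limit to the limit of the image diagram is an effective epimorphism. -/
def PosFunctor.LeftCovering {C : Type u₁} [Category.{v₁} C] [PosEnriched C]
    {E : Type u₂} [Category.{v₂} E] [PosEnriched E] (F : PosFunctor C E) : Prop :=
  ∀ ⦃I : Type⦄ [Category.{0} I] [PosEnriched I] (W : PosFunctor I PartOrd.{0}),
    IsFiniteWeight W → ∀ (D : PosFunctor I C) (L : C) (c : WeightedCone W D L), c.IsWeakLimit →
      ∀ (M : E) (d : WeightedCone W (D.comp F) M), d.IsLimit →
        ∀ t : F.obj L ⟶ M, d.precomp t = c.map F → IsEffectiveEpi t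

/-! ## Pullbacks, comma objects, products and inserters as weighted limits -/

section Shapes

theorem comp_comp_of_eq {C : Type u} [Category.{v} C] {A L X Z : C} {n : A ⟶ L} {l : L ⟶ X}
    {x : A ⟶ X} (h : n ≫ l = x) (f : X ⟶ Z) : n ≫ l ≫ f = x ≫ f := by
  rw [← Category.assoc, h]

instance : PosEnriched WalkingCospan := discreteEnriched _
instance : PosEnriched WalkingParallelPair := discreteEnriched _
instance : PosEnriched (Discrete WalkingPair) := discreteEnriched _

/-- The weight on a cospan with values `1 → P ← 1`, picking out `a` and `b`. -/
def cospanWeight (P : Type) [PartialOrder P] (a b : P) : PosFunctor WalkingCospan PartOrd.{0} where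
  toFunctor := cospan (PartOrd.ofHom (OrderHom.const PUnit a) : PartOrd.of PUnit ⟶ PartOrd.of P)
    (PartOrd.ofHom (OrderHom.const PUnit b) : PartOrd.of PUnit ⟶ PartOrd.of P)
  monotone_map h := by
    cases h
    exact le_rfl

/-- The weight for inserters. -/
def inserterWeight : PosFunctor WalkingParallelPair PartOrd.{0} where
  toFunctor := parallelPair
    (PartOrd.ofHom (OrderHom.const PUnit false) : PartOrd.of PUnit ⟶ PartOrd.of Bool)
    (PartOrd.ofHom (OrderHom.const PUnit true) : PartOrd.of PUnit ⟶ PartOrd.of Bool)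
  monotone_map h := by
    cases h
    exact le_rfl

/-- The weight for binary products. -/
def pairWeight : PosFunctor (Discrete WalkingPair) PartOrd.{0} where
  toFunctor := (Functor.const _).obj (PartOrd.of PUnit)
  monotone_map h := by
    cases h
    exact le_rfl

theorem cospanWeight_finite (P : Type) [PartialOrder P] [Finite P] (a b : P) :
    IsFiniteWeight (cospanWeight P a b) where
  finite_objects := by
    have : Finite WalkingCospan := inferInstanceAs (Finite (Option WalkingPair))
    infer_instance
  finite_hom _ _ := inferInstance
  finite_values i := by
    match i with
    | WalkingCospan.left => exact inferInstanceAs (Finite PUnit)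
    | WalkingCospan.right => exact inferInstanceAs (Finite PUnit)
    | WalkingCospan.one => exact inferInstanceAs (Finite P)

theorem inserterWeight_finite : IsFiniteWeight inserterWeight where
  finite_objects := inferInstance
  finite_hom _ _ := inferInstance
  finite_values i := by
    match i with
    | WalkingParallelPair.zero => exact inferInstanceAs (Finite PUnit)
    | WalkingParallelPair.one => exact inferInstanceAs (Finite Bool)

theorem pairWeight_finite : IsFiniteWeight pairWeight where
  finite_objects := inferInstance
  finite_hom _ _ := inferInstance
  finite_values _ := inferInstanceAs (Finite PUnit)

variable {C : Type u} [Category.{v} C] [PosEnriched C]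

/-- The diagram given by a cospan. -/
def cospanDiagram {X Y Z : C} (f : X ⟶ Z) (g : Y ⟶ Z) : PosFunctor WalkingCospan C where
  toFunctor := cospan f g
  monotone_map h := by
    cases h
    exact le_rfl

/-- The diagram given by a parallel pair. -/
def parallelDiagram {X Y : C} (f g : X ⟶ Y) : PosFunctor WalkingParallelPair C where
  toFunctor := parallelPair f g
  monotone_map h := by
    cases h
    exact le_rfl

/-- The diagram given by two objects. -/
def pairDiagram (X Y : C) : PosFunctor (Discrete WalkingPair) C where
  toFunctor := pair X Y
  monotone_map h := by
    cases h
    exact le_rfl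

section Cospan

variable {P : Type} [PartialOrder P] {a b : P} {D : PosFunctor WalkingCospan C} {L : C}

/-- Cones for the weight `cospanWeight P a b`. -/
def cospanCone (l : L ⟶ D.obj WalkingCospan.left) (r : L ⟶ D.obj WalkingCospan.right)
    (z : P → (L ⟶ D.obj WalkingCospan.one)) (hz : Monotone z)
    (ha : z a = l ≫ D.map WalkingCospan.Hom.inl) (hb : z b = r ≫ D.map WalkingCospan.Hom.inr) :
    WeightedCone (cospanWeight P a b) D L where
  app i := match i with
    | WalkingCospan.left => fun _ => l
    | WalkingCospan.right => fun _ => r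
    | WalkingCospan.one => z
  monotone_app i := match i with
    | WalkingCospan.left => fun _ _ _ => le_rfl
    | WalkingCospan.right => fun _ _ _ => le_rfl
    | WalkingCospan.one => hz
  naturality {i j} α w := by
    change WidePullbackShape.Hom i j at α
    cases α with
    | id =>
      rw [show WidePullbackShape.Hom.id i = 𝟙 i from rfl, CategoryTheory.Functor.map_id,
        CategoryTheory.Functor.map_id, Category.comp_id]
      rfl
    | term j =>
      cases j with
      | left => exact ha
      | right => exact hb

theorem cospanCone_isWeakLimit {l : L ⟶ D.obj WalkingCospan.left}
    {r : L ⟶ D.obj WalkingCospan.right} {z : P → (L ⟶ D.obj WalkingCospan.one)}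
    {hz : Monotone z} {ha : z a = l ≫ D.map WalkingCospan.Hom.inl}
    {hb : z b = r ≫ D.map WalkingCospan.Hom.inr}
    (h : ∀ (A : C) (x : A ⟶ D.obj WalkingCospan.left) (y : A ⟶ D.obj WalkingCospan.right)
      (ζ : P → (A ⟶ D.obj WalkingCospan.one)), Monotone ζ →
      ζ a = x ≫ D.map WalkingCospan.Hom.inl → ζ b = y ≫ D.map WalkingCospan.Hom.inr →
      ∃ t : A ⟶ L, t ≫ l = x ∧ t ≫ r = y ∧ ∀ p, t ≫ z p = ζ p) :
    (cospanCone (a := a) (b := b) (D := D) l r z hz ha hb).IsWeakLimit := by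
  intro A s
  obtain ⟨t, h₁, h₂, h₃⟩ := h A (s.app WalkingCospan.left PUnit.unit)
    (s.app WalkingCospan.right PUnit.unit) (s.app WalkingCospan.one)
    (s.monotone_app WalkingCospan.one)
    (s.naturality WalkingCospan.Hom.inl PUnit.unit) (s.naturality WalkingCospan.Hom.inr PUnit.unit)
  refine ⟨t, ?_⟩
  ext i w
  match i with
  | WalkingCospan.left => exact h₁
  | WalkingCospan.right => exact h₂
  | WalkingCospan.one => exact h₃ w

theorem WeightedCone.IsWeakLimit.cospan_lift {c : WeightedCone (cospanWeight P a b) D L}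
    (hc : c.IsWeakLimit) {A : C} (x : A ⟶ D.obj WalkingCospan.left)
    (y : A ⟶ D.obj WalkingCospan.right) (ζ : P → (A ⟶ D.obj WalkingCospan.one))
    (hζ : Monotone ζ) (ha : ζ a = x ≫ D.map WalkingCospan.Hom.inl)
    (hb : ζ b = y ≫ D.map WalkingCospan.Hom.inr) :
    ∃ t : A ⟶ L, t ≫ c.app WalkingCospan.left PUnit.unit = x ∧
      t ≫ c.app WalkingCospan.right PUnit.unit = y := by
  obtain ⟨t, ht⟩ := hc A (cospanCone x y ζ hζ ha hb)
  refine ⟨t, ?_, ?_⟩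
  · exact congrArg (fun k => WeightedCone.app k WalkingCospan.left PUnit.unit) ht
  · exact congrArg (fun k => WeightedCone.app k WalkingCospan.right PUnit.unit) ht

end Cospan

theorem comp_le_comp_of_eq {A L X Z : C} {s t : A ⟶ L} {l : L ⟶ X} {f : X ⟶ Z} {k : L ⟶ Z}
    (w : k = l ≫ f) (h : s ≫ l ≤ t ≫ l) : s ≫ k ≤ t ≫ k := by
  rw [w, ← Category.assoc, ← Category.assoc]
  exact PosEnriched.comp_le_comp h le_rfl

theorem bool_monotone {α : Type*} [PartialOrder α] {x y : α} (h : x ≤ y) :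
    Monotone (fun p : Bool => bif p then y else x) := by
  intro p q hpq
  cases p <;> cases q <;> first | exact le_rfl | exact h | exact absurd hpq (by decide)

theorem exists_weakPullback [WeaklyLex C] {X Y Z : C} (f : X ⟶ Z) (g : Y ⟶ Z) :
    ∃ (P : C) (p₀ : P ⟶ X) (p₁ : P ⟶ Y), IsWeakPullback p₀ p₁ f g := by
  obtain ⟨L, c, hc⟩ := WeaklyLex.exists_weakLimit (C := C) _
    (cospanWeight_finite PUnit PUnit.unit PUnit.unit) (cospanDiagram f g)
  refine ⟨L, c.app WalkingCospan.left PUnit.unit, c.app WalkingCospan.right PUnit.unit, ?_, ?_⟩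
  · exact (c.naturality WalkingCospan.Hom.inl PUnit.unit).symm.trans
      (c.naturality WalkingCospan.Hom.inr PUnit.unit)
  · intro A x y h
    exact hc.cospan_lift x y (fun _ => x ≫ f) (fun _ _ _ => le_rfl) rfl h

theorem exists_pullback [Lex C] {X Y Z : C} (f : X ⟶ Z) (g : Y ⟶ Z) :
    ∃ (P : C) (p₀ : P ⟶ X) (p₁ : P ⟶ Y), IsPosPullback p₀ p₁ f g := by
  obtain ⟨L, c, hc⟩ := Lex.exists_limit (C := C) _
    (cospanWeight_finite PUnit PUnit.unit PUnit.unit) (cospanDiagram f g)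
  have w₀ := c.naturality WalkingCospan.Hom.inl PUnit.unit
  have w₁ := c.naturality WalkingCospan.Hom.inr PUnit.unit
  refine ⟨L, c.app WalkingCospan.left PUnit.unit, c.app WalkingCospan.right PUnit.unit,
    ⟨w₀.symm.trans w₁, ?_⟩, ?_⟩
  · intro A x y h
    exact WeightedCone.IsWeakLimit.cospan_lift hc.surjective x y (fun _ => x ≫ f)
      (fun _ _ _ => le_rfl) rfl h
  · intro A s t h₀ h₁
    refine hc.le_of_precomp_le s t ?_
    rintro (_ | _ | _) ⟨⟩
    · change s ≫ _ ≤ t ≫ _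
      exact comp_le_comp_of_eq w₀ h₀
    · exact h₀
    · exact h₁

theorem exists_comma [Lex C] {X Y Z : C} (f : X ⟶ Z) (g : Y ⟶ Z) :
    ∃ (P : C) (c₀ : P ⟶ X) (c₁ : P ⟶ Y), IsComma c₀ c₁ f g := by
  obtain ⟨L, c, hc⟩ := Lex.exists_limit (C := C) _
    (cospanWeight_finite Bool false true) (cospanDiagram f g)
  have w₀ : c.app WalkingCospan.one false = c.app WalkingCospan.left PUnit.unit ≫ f :=
    c.naturality WalkingCospan.Hom.inl PUnit.unit
  have w₁ : c.app WalkingCospan.one true = c.app WalkingCospan.right PUnit.unit ≫ g :=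
    c.naturality WalkingCospan.Hom.inr PUnit.unit
  refine ⟨L, c.app WalkingCospan.left PUnit.unit, c.app WalkingCospan.right PUnit.unit, ?_, ?_, ?_⟩
  · exact w₀.ge.trans ((c.monotone_app WalkingCospan.one (Bool.false_le true)).trans w₁.le)
  · intro A x y h
    exact WeightedCone.IsWeakLimit.cospan_lift hc.surjective x y
      (fun p => bif p then y ≫ g else x ≫ f) (bool_monotone h) rfl rfl
  · intro A s t h₀ h₁
    refine hc.le_of_precomp_le s t ?_
    rintro (_ | _ | _) w
    · change s ≫ _ ≤ t ≫ _
      cases w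
      · exact comp_le_comp_of_eq w₀ h₀
      · exact comp_le_comp_of_eq w₁ h₁
    · exact h₀
    · exact h₁

theorem exists_weakComma [WeaklyLex C] {X Y Z : C} (f : X ⟶ Z) (g : Y ⟶ Z) :
    ∃ (P : C) (c₀ : P ⟶ X) (c₁ : P ⟶ Y), c₀ ≫ f ≤ c₁ ≫ g ∧
      ∀ (A : C) (x : A ⟶ X) (y : A ⟶ Y), x ≫ f ≤ y ≫ g →
        ∃ t : A ⟶ P, t ≫ c₀ = x ∧ t ≫ c₁ = y := by
  obtain ⟨L, c, hc⟩ := WeaklyLex.exists_weakLimit (C := C) _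
    (cospanWeight_finite Bool false true) (cospanDiagram f g)
  have w₀ : c.app WalkingCospan.one false = c.app WalkingCospan.left PUnit.unit ≫ f :=
    c.naturality WalkingCospan.Hom.inl PUnit.unit
  have w₁ : c.app WalkingCospan.one true = c.app WalkingCospan.right PUnit.unit ≫ g :=
    c.naturality WalkingCospan.Hom.inr PUnit.unit
  refine ⟨L, c.app WalkingCospan.left PUnit.unit, c.app WalkingCospan.right PUnit.unit, ?_, ?_⟩
  · exact w₀.ge.trans ((c.monotone_app WalkingCospan.one (Bool.false_le true)).trans w₁.le)
  · intro A x y h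
    exact hc.cospan_lift x y
      (fun p => bif p then y ≫ g else x ≫ f) (bool_monotone h) rfl rfl

theorem exists_inserter [Lex C] {X Y : C} (f g : X ⟶ Y) :
    ∃ (L : C) (i : L ⟶ X), IsFF i ∧ i ≫ f ≤ i ≫ g ∧
      ∀ (A : C) (x : A ⟶ X), x ≫ f ≤ x ≫ g → ∃ t : A ⟶ L, t ≫ i = x := by
  obtain ⟨L, c, hc⟩ := Lex.exists_limit (C := C) _ inserterWeight_finite (parallelDiagram f g)
  have w₀ : c.app WalkingParallelPair.one false = c.app WalkingParallelPair.zero PUnit.unit ≫ f :=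
    c.naturality WalkingParallelPairHom.left PUnit.unit
  have w₁ : c.app WalkingParallelPair.one true = c.app WalkingParallelPair.zero PUnit.unit ≫ g :=
    c.naturality WalkingParallelPairHom.right PUnit.unit
  refine ⟨L, c.app WalkingParallelPair.zero PUnit.unit, ?_, ?_, ?_⟩
  · intro A s t h
    refine hc.le_of_precomp_le s t ?_
    rintro (_ | _) w
    · exact h
    · change s ≫ _ ≤ t ≫ _
      cases w
      · exact comp_le_comp_of_eq w₀ h
      · exact comp_le_comp_of_eq w₁ h
  · exact w₀.ge.trans ((c.monotone_app WalkingParallelPair.one (Bool.false_le true)).trans w₁.le)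
  · intro A x h
    let s : WeightedCone inserterWeight (parallelDiagram f g) A :=
      { app := fun i => match i with
          | WalkingParallelPair.zero => fun _ => x
          | WalkingParallelPair.one => fun p => bif p then x ≫ g else x ≫ f
        monotone_app := fun i => match i with
          | WalkingParallelPair.zero => fun _ _ _ => le_rfl
          | WalkingParallelPair.one => bool_monotone h
        naturality := by
          intro i j α w
          change WalkingParallelPairHom i j at α
          cases α with
          | left => rfl
          | right => rfl
          | id =>
            rw [show WalkingParallelPairHom.id i = 𝟙 i from rfl, CategoryTheory.Functor.map_id,
              CategoryTheory.Functor.map_id, Category.comp_id]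
            rfl }
    obtain ⟨t, ht⟩ := hc.surjective A s
    refine ⟨t, ?_⟩
    exact congrArg (fun k => WeightedCone.app k WalkingParallelPair.zero PUnit.unit) ht

theorem exists_product [Lex C] (X Y : C) :
    ∃ (P : C) (p₀ : P ⟶ X) (p₁ : P ⟶ Y),
      (∀ (A : C) (x : A ⟶ X) (y : A ⟶ Y), ∃ t : A ⟶ P, t ≫ p₀ = x ∧ t ≫ p₁ = y) ∧
      ∀ (A : C) (s t : A ⟶ P), s ≫ p₀ ≤ t ≫ p₀ → s ≫ p₁ ≤ t ≫ p₁ → s ≤ t := by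
  obtain ⟨L, c, hc⟩ := Lex.exists_limit (C := C) _ pairWeight_finite (pairDiagram X Y)
  refine ⟨L, c.app ⟨WalkingPair.left⟩ PUnit.unit, c.app ⟨WalkingPair.right⟩ PUnit.unit, ?_, ?_⟩
  · intro A x y
    let s : WeightedCone pairWeight (pairDiagram X Y) A :=
      { app := fun i => match i with
          | ⟨WalkingPair.left⟩ => fun _ => x
          | ⟨WalkingPair.right⟩ => fun _ => y
        monotone_app := fun _ _ _ _ => le_rfl
        naturality := by
          rintro ⟨i⟩ ⟨j⟩ ⟨⟨α⟩⟩ w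
          cases α
          cases i <;> exact (Category.comp_id _).symm }
    obtain ⟨t, ht⟩ := hc.surjective A s
    exact ⟨t, congrArg (fun k => WeightedCone.app k ⟨WalkingPair.left⟩ PUnit.unit) ht,
      congrArg (fun k => WeightedCone.app k ⟨WalkingPair.right⟩ PUnit.unit) ht⟩
  · intro A s t h₀ h₁
    refine hc.le_of_precomp_le s t ?_
    rintro ⟨_ | _⟩ ⟨⟩
    · exact h₀
    · exact h₁

end Shapes

/-! ## The exact completion -/

/-- A pseudocongruence `r₀, r₁ : R ⟶ X`. -/
structure Pseudocongruence (C : Type u) [Category.{v} C] [PosEnriched C] where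
  X : C
  R : C
  r₀ : R ⟶ X
  r₁ : R ⟶ X
  order_reflexive {A : C} (a₀ a₁ : A ⟶ X) : a₀ ≤ a₁ → ∃ t : A ⟶ R, t ≫ r₀ = a₀ ∧ t ≫ r₁ = a₁
  transitive {Q : C} (d₀ d₁ : Q ⟶ R) :
    IsWeakPullback d₀ d₁ r₁ r₀ → ∃ τ : Q ⟶ R, τ ≫ r₀ = d₀ ≫ r₀ ∧ τ ≫ r₁ = d₁ ≫ r₁

section ExactCompletion

variable {C : Type u} [Category.{v} C] [PosEnriched C]

/-- The morphisms of `C` that represent morphisms `(X, R) ⟶ (Y, S)` of the exact completion. -/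
@[ext]
structure Representative (P Q : Pseudocongruence C) where
  f : P.X ⟶ Q.X
  compatible : ∃ f' : P.R ⟶ Q.R, f' ≫ Q.r₀ = P.r₀ ≫ f ∧ f' ≫ Q.r₁ = P.r₁ ≫ f

variable [WeaklyLex C]

theorem Pseudocongruence.related_trans (P : Pseudocongruence C) {A : C} {x y z : A ⟶ P.X}
    (h : Related P.r₀ P.r₁ x y) (k : Related P.r₀ P.r₁ y z) : Related P.r₀ P.r₁ x z := by
  obtain ⟨s, hs₀, hs₁⟩ := h
  obtain ⟨t, ht₀, ht₁⟩ := k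
  obtain ⟨Q, d₀, d₁, hQ⟩ := exists_weakPullback P.r₁ P.r₀
  obtain ⟨τ, hτ₀, hτ₁⟩ := P.transitive d₀ d₁ hQ
  obtain ⟨n, hn₀, hn₁⟩ := hQ.exists_lift s t (hs₁.trans ht₀.symm)
  refine ⟨n ≫ τ, ?_, ?_⟩
  · rw [Category.assoc, hτ₀, ← Category.assoc, hn₀, hs₀]
  · rw [Category.assoc, hτ₁, ← Category.assoc, hn₁, ht₁]

/-- The preorder on representatives: `f ≼ g` if `(f, g)` factors through `(s₀, s₁)`. -/
instance (P Q : Pseudocongruence C) : Preorder (Representative P Q) where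
  le φ ψ := ∃ σ : P.X ⟶ Q.R, σ ≫ Q.r₀ = φ.f ∧ σ ≫ Q.r₁ = ψ.f
  le_refl φ := Q.order_reflexive φ.f φ.f le_rfl
  le_trans _ _ _ h k := Q.related_trans h k

/-- Identity representative. -/
def Representative.id (P : Pseudocongruence C) : Representative P P :=
  ⟨𝟙 _, 𝟙 _, by simp, by simp⟩

/-- Composite of representatives. -/
def Representative.comp {P Q T : Pseudocongruence C} (φ : Representative P Q)
    (ψ : Representative Q T) : Representative P T :=
  ⟨φ.f ≫ ψ.f, by
    obtain ⟨f', h₀, h₁⟩ := φ.compatible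
    obtain ⟨g', k₀, k₁⟩ := ψ.compatible
    refine ⟨f' ≫ g', ?_, ?_⟩
    · rw [Category.assoc, k₀, ← Category.assoc, h₀, Category.assoc]
    · rw [Category.assoc, k₁, ← Category.assoc, h₁, Category.assoc]⟩

theorem Representative.comp_le_comp {P Q T : Pseudocongruence C} {φ φ' : Representative P Q}
    {ψ ψ' : Representative Q T} (h : φ ≤ φ') (k : ψ ≤ ψ') : φ.comp ψ ≤ φ'.comp ψ' := by
  obtain ⟨σ, hσ₀, hσ₁⟩ := h
  obtain ⟨ρ, hρ₀, hρ₁⟩ := k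
  obtain ⟨g', k₀, k₁⟩ := ψ.compatible
  refine T.related_trans (y := φ'.f ≫ ψ.f) ⟨σ ≫ g', ?_, ?_⟩ ⟨φ'.f ≫ ρ, ?_, ?_⟩
  · rw [Category.assoc, k₀, ← Category.assoc, hσ₀]; rfl
  · rw [Category.assoc, k₁, ← Category.assoc, hσ₁]
  · rw [Category.assoc, hρ₀]
  · rw [Category.assoc, hρ₁]; rfl

/-- The exact completion of a weakly lex poset-enriched category. Its objects are the
pseudocongruences, its morphisms the classes of representatives under the equivalence relation
of the preorder `≼`. -/
abbrev ExactCompletion (C : Type u) [Category.{v} C] [PosEnriched C] := Pseudocongruence C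

instance : Category.{v} (ExactCompletion C) where
  Hom P Q := Antisymmetrization (Representative P Q) (· ≤ ·)
  id P := toAntisymmetrization _ (Representative.id P)
  comp := Quotient.map₂ Representative.comp (fun _ _ h _ _ k =>
    ⟨Representative.comp_le_comp h.1 k.1, Representative.comp_le_comp h.2 k.2⟩)
  id_comp := by
    rintro P Q ⟨φ⟩
    exact congrArg (toAntisymmetrization _) (Representative.ext (Category.id_comp φ.f))
  comp_id := by
    rintro P Q ⟨φ⟩
    exact congrArg (toAntisymmetrization _) (Representative.ext (Category.comp_id φ.f))
  assoc := by
    rintro P Q T U ⟨φ⟩ ⟨ψ⟩ ⟨χ⟩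
    exact congrArg (toAntisymmetrization _) (Representative.ext (Category.assoc φ.f ψ.f χ.f))

instance : PosEnriched (ExactCompletion C) where
  homOrder P Q := inferInstanceAs (PartialOrder (Antisymmetrization (Representative P Q) (· ≤ ·)))
  comp_le_comp := by
    rintro P Q T ⟨φ⟩ ⟨φ'⟩ ⟨ψ⟩ ⟨ψ'⟩ h k
    exact Representative.comp_le_comp (φ := φ) (φ' := φ') (ψ := ψ) (ψ' := ψ') h k

end ExactCompletion

/-! ## Basic facts on regular categories -/

section RegularFacts

variable {C : Type u} [Category.{v} C] [PosEnriched C]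

theorem IsFF.eq_of_eq {X Y Z : C} {m : X ⟶ Y} (hm : IsFF m) {s t : Z ⟶ X}
    (h : s ≫ m = t ≫ m) : s = t :=
  le_antisymm (hm _ _ h.le) (hm _ _ h.ge)

theorem IsEffectiveEpi.isSo {A B : C} {e : A ⟶ B} (he : IsEffectiveEpi e) : IsSo e := by
  obtain ⟨K, k₀, k₁, he⟩ := he
  refine ⟨fun m hm s t h => ?_, fun _ _ d d' h _ => he.le_of_le d d' h⟩
  have hs : k₀ ≫ s ≤ k₁ ≫ s := by
    apply hm
    rw [Category.assoc, Category.assoc, h, ← Category.assoc, ← Category.assoc]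
    exact PosEnriched.comp_le_comp he.w le_rfl
  obtain ⟨d, hd⟩ := he.exists_desc s hs
  refine ⟨d, hd, ?_⟩
  have : e ≫ d ≫ m = e ≫ t := by rw [← Category.assoc, hd, h]
  exact le_antisymm (he.le_of_le _ _ this.le) (he.le_of_le _ _ this.ge)

theorem IsSo.comp {X Y Z : C} {e : X ⟶ Y} {e' : Y ⟶ Z} (h : IsSo e) (h' : IsSo e') :
    IsSo (e ≫ e') := by
  refine ⟨fun m hm s t w => ?_, fun m hm d d' k k' => hm _ _ k'⟩
  obtain ⟨d, hd, hd'⟩ := h.exists_fill m hm s (e' ≫ t) (by rw [w, Category.assoc])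
  obtain ⟨c, hc, hc'⟩ := h'.exists_fill m hm d t hd'
  exact ⟨c, by rw [Category.assoc, hc, hd], hc'⟩

theorem IsSo.of_comp {X Y Z : C} {e : X ⟶ Y} {e' : Y ⟶ Z} (h : IsSo (e ≫ e')) : IsSo e' := by
  refine ⟨fun m hm s t w => ?_, fun m hm d d' k k' => hm _ _ k'⟩
  obtain ⟨d, hd, hd'⟩ := h.exists_fill m hm (e ≫ s) t (by rw [Category.assoc, w, Category.assoc])
  exact ⟨d, hm.eq_of_eq (by rw [Category.assoc, hd', w]), hd'⟩

theorem IsSo.exists_inv {X Y : C} {e : X ⟶ Y} (h : IsSo e) (h' : IsFF e) :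
    ∃ d : Y ⟶ X, e ≫ d = 𝟙 _ ∧ d ≫ e = 𝟙 _ :=
  h.exists_fill e h' (𝟙 _) (𝟙 _) (by simp)

/-- In the presence of inserters, `so`-morphisms are order-epimorphisms. -/
theorem IsSo.le_of_comp_le [Lex C] {X Y Z : C} {e : X ⟶ Y} (h : IsSo e) {s t : Y ⟶ Z}
    (w : e ≫ s ≤ e ≫ t) : s ≤ t := by
  obtain ⟨L, i, hi, hst, hu⟩ := exists_inserter s t
  obtain ⟨n, hn⟩ := hu _ e w
  obtain ⟨d, -, hd⟩ := h.exists_fill i hi n (𝟙 _) (by rw [hn, Category.comp_id])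
  have := PosEnriched.comp_le_comp (le_refl d) hst
  rwa [← Category.assoc, ← Category.assoc, hd, Category.id_comp, Category.id_comp] at this

theorem IsSo.exists_fill_pair [Lex C] {A B S X Y : C} {e : A ⟶ B} (h : IsSo e) {s₀ : S ⟶ X}
    {s₁ : S ⟶ Y}
    (hs : ∀ (T : C) (s t : T ⟶ S), s ≫ s₀ ≤ t ≫ s₀ → s ≫ s₁ ≤ t ≫ s₁ → s ≤ t)
    (n : A ⟶ S) (x : B ⟶ X) (y : B ⟶ Y) (hx : n ≫ s₀ = e ≫ x) (hy : n ≫ s₁ = e ≫ y) :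
    ∃ d : B ⟶ S, d ≫ s₀ = x ∧ d ≫ s₁ = y := by
  obtain ⟨P, p₀, p₁, hP, hP'⟩ := exists_product X Y
  obtain ⟨m, hm₀, hm₁⟩ := hP S s₀ s₁
  obtain ⟨b, hb₀, hb₁⟩ := hP B x y
  have hm : IsFF m := by
    intro T s t w
    refine hs T s t ?_ ?_
    · rw [← hm₀, ← Category.assoc, ← Category.assoc]
      exact PosEnriched.comp_le_comp w le_rfl
    · rw [← hm₁, ← Category.assoc, ← Category.assoc]
      exact PosEnriched.comp_le_comp w le_rfl
  have hw : n ≫ m = e ≫ b := by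
    apply le_antisymm <;> apply hP' <;>
      simp only [Category.assoc, hm₀, hm₁, hb₀, hb₁, hx, hy, le_refl]
  obtain ⟨d, -, hd⟩ := h.exists_fill m hm n b hw
  exact ⟨d, by rw [← hm₀, ← Category.assoc, hd, hb₀], by rw [← hm₁, ← Category.assoc, hd, hb₁]⟩

variable [Regular C]

theorem IsSo.exists_cover {A B X : C} {e : A ⟶ B} (h : IsSo e) (x : X ⟶ B) :
    ∃ (X' : C) (c : X' ⟶ X) (x' : X' ⟶ A), IsSo c ∧ c ≫ x = x' ≫ e := by
  obtain ⟨P, p₀, p₁, hP⟩ := exists_pullback x e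
  exact ⟨P, p₀, p₁, Regular.so_stable hP h, hP.w⟩

/-- An `so`-morphism is the coinserter of its kernel congruence. -/
theorem IsSo.isCoinserter {A B K : C} {e : A ⟶ B} (h : IsSo e) {k₀ k₁ : K ⟶ A}
    (hK : IsComma k₀ k₁ e e) : IsCoinserter k₀ k₁ e := by
  refine ⟨hK.w, fun {Z} g hg => ?_, fun s t w => h.le_of_comp_le w⟩
  obtain ⟨P, p₀, p₁, hP, hP'⟩ := exists_product B Z
  obtain ⟨n, hn₀, hn₁⟩ := hP A e g
  obtain ⟨J, p, m, hp, hm, hpm⟩ := Regular.exists_factorization n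
  have hpb : p ≫ m ≫ p₀ = e := by rw [← Category.assoc, hpm, hn₀]
  have hpz : p ≫ m ≫ p₁ = g := by rw [← Category.assoc, hpm, hn₁]
  have hb : IsSo (m ≫ p₀) := IsSo.of_comp (e := p) (by rwa [hpb])
  have hb' : IsFF (m ≫ p₀) := by
    intro T s t w
    obtain ⟨T₁, c₁, s', hc₁, hs'⟩ := hp.exists_cover s
    obtain ⟨T₂, c₂, t', hc₂, ht'⟩ := hp.exists_cover (c₁ ≫ t)
    have w' : (c₂ ≫ s') ≫ e ≤ t' ≫ e := by
      rw [← hpb, Category.assoc, ← Category.assoc s', ← hs', ← Category.assoc t', ← ht']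
      simp only [Category.assoc]
      exact PosEnriched.comp_le_comp le_rfl (PosEnriched.comp_le_comp le_rfl w)
    obtain ⟨k, hk₀, hk₁⟩ := hK.exists_lift _ _ w'
    have w'' : (c₂ ≫ s') ≫ g ≤ t' ≫ g := by
      rw [← hk₀, ← hk₁, Category.assoc, Category.assoc]
      exact PosEnriched.comp_le_comp le_rfl hg
    apply hm
    refine hP' _ _ _ ?_ ?_
    · simpa only [Category.assoc] using w
    · apply (hc₂.comp hc₁).le_of_comp_le
      rw [← hpz, Category.assoc, ← Category.assoc s', ← hs', ← Category.assoc t', ← ht'] at w''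
      simpa only [Category.assoc] using w''
  obtain ⟨d, hd, -⟩ := hb.exists_inv hb'
  refine ⟨d ≫ m ≫ p₁, ?_⟩
  calc e ≫ d ≫ m ≫ p₁ = p ≫ ((m ≫ p₀) ≫ d) ≫ m ≫ p₁ := by
        rw [← hpb]; simp only [Category.assoc]
    _ = g := by rw [hd, Category.id_comp, hpz]

end RegularFacts

/-! ## The extension of a left covering functor to the exact completion -/

section Extension

variable {C : Type u₁} [Category.{v₁} C] [PosEnriched C]
variable {E : Type u₂} [Category.{v₂} E] [PosEnriched E]

theorem PosFunctor.LeftCovering.pullback {F : PosFunctor C E} (hF : F.LeftCovering)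
    {P X Y Z : C} {p₀ : P ⟶ X} {p₁ : P ⟶ Y} {f : X ⟶ Z} {g : Y ⟶ Z}
    (hP : IsWeakPullback p₀ p₁ f g) {Q : E} {q₀ : Q ⟶ F.obj X} {q₁ : Q ⟶ F.obj Y}
    (hQ : IsPosPullback q₀ q₁ (F.map f) (F.map g)) (t : F.obj P ⟶ Q)
    (h₀ : t ≫ q₀ = F.map p₀) (h₁ : t ≫ q₁ = F.map p₁) : IsSo t := by
  let D := cospanDiagram f g
  let c : WeightedCone (cospanWeight PUnit PUnit.unit PUnit.unit) D P :=
    cospanCone p₀ p₁ (fun _ => p₀ ≫ f) (fun _ _ _ => le_rfl) rfl hP.w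
  have hc : c.IsWeakLimit := by
    refine cospanCone_isWeakLimit fun A x y ζ hζ ha hb => ?_
    obtain ⟨n, hn₀, hn₁⟩ := hP.exists_lift x y (ha.symm.trans hb)
    refine ⟨n, hn₀, hn₁, fun _ => ?_⟩
    exact (comp_comp_of_eq hn₀ _).trans ha.symm
  let d : WeightedCone (cospanWeight PUnit PUnit.unit PUnit.unit) (D.comp F) Q :=
    cospanCone q₀ q₁ (fun _ => q₀ ≫ F.map f) (fun _ _ _ => le_rfl) rfl hQ.w
  have hd : d.IsLimit := by
    refine ⟨cospanCone_isWeakLimit fun A x y ζ hζ ha hb => ?_, fun s t w => ?_⟩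
    · obtain ⟨n, hn₀, hn₁⟩ := hQ.exists_lift x y (ha.symm.trans hb)
      refine ⟨n, hn₀, hn₁, fun _ => ?_⟩
      exact (comp_comp_of_eq hn₀ _).trans ha.symm
    · exact hQ.le_of_le s t (w WalkingCospan.left PUnit.unit) (w WalkingCospan.right PUnit.unit)
  refine (hF _ (cospanWeight_finite _ _ _) D P c hc Q d hd t ?_).isSo
  ext i w
  match i with
  | WalkingCospan.left => exact h₀
  | WalkingCospan.right => exact h₁
  | WalkingCospan.one =>
    change t ≫ q₀ ≫ F.map f = F.map (p₀ ≫ f)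
    rw [← Category.assoc, h₀, F.map_comp]

theorem PosFunctor.LeftCovering.comma {F : PosFunctor C E} (hF : F.LeftCovering)
    {P X Y Z : C} {p₀ : P ⟶ X} {p₁ : P ⟶ Y} {f : X ⟶ Z} {g : Y ⟶ Z}
    (hw : p₀ ≫ f ≤ p₁ ≫ g)
    (hP : ∀ (A : C) (x : A ⟶ X) (y : A ⟶ Y), x ≫ f ≤ y ≫ g →
      ∃ t : A ⟶ P, t ≫ p₀ = x ∧ t ≫ p₁ = y)
    {Q : E} {q₀ : Q ⟶ F.obj X} {q₁ : Q ⟶ F.obj Y}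
    (hQ : IsComma q₀ q₁ (F.map f) (F.map g)) (t : F.obj P ⟶ Q)
    (h₀ : t ≫ q₀ = F.map p₀) (h₁ : t ≫ q₁ = F.map p₁) : IsSo t := by
  let D := cospanDiagram f g
  let c : WeightedCone (cospanWeight Bool false true) D P :=
    cospanCone p₀ p₁ (fun p => bif p then p₁ ≫ g else p₀ ≫ f) (bool_monotone hw) rfl rfl
  have hc : c.IsWeakLimit := by
    refine cospanCone_isWeakLimit fun A x y ζ hζ ha hb => ?_
    obtain ⟨n, hn₀, hn₁⟩ := hP A x y (ha.ge.trans ((hζ (Bool.false_le true)).trans hb.le))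
    refine ⟨n, hn₀, hn₁, fun p => ?_⟩
    cases p
    · exact (comp_comp_of_eq hn₀ _).trans ha.symm
    · exact (comp_comp_of_eq hn₁ _).trans hb.symm
  let d : WeightedCone (cospanWeight Bool false true) (D.comp F) Q :=
    cospanCone q₀ q₁ (fun p => bif p then q₁ ≫ F.map g else q₀ ≫ F.map f) (bool_monotone hQ.w)
      rfl rfl
  have hd : d.IsLimit := by
    refine ⟨cospanCone_isWeakLimit fun A x y ζ hζ ha hb => ?_, fun s t w => ?_⟩
    · obtain ⟨n, hn₀, hn₁⟩ :=
        hQ.exists_lift x y (ha.ge.trans ((hζ (Bool.false_le true)).trans hb.le))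
      refine ⟨n, hn₀, hn₁, fun p => ?_⟩
      cases p
      · exact (comp_comp_of_eq hn₀ _).trans ha.symm
      · exact (comp_comp_of_eq hn₁ _).trans hb.symm
    · exact hQ.le_of_le s t (w WalkingCospan.left PUnit.unit) (w WalkingCospan.right PUnit.unit)
  refine (hF _ (cospanWeight_finite _ _ _) D P c hc Q d hd t ?_).isSo
  ext i w
  match i with
  | WalkingCospan.left => exact h₀
  | WalkingCospan.right => exact h₁
  | WalkingCospan.one =>
    cases w
    · change t ≫ q₀ ≫ F.map f = F.map (p₀ ≫ f)
      rw [← Category.assoc, h₀, F.map_comp]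
    · change t ≫ q₁ ≫ F.map g = F.map (p₁ ≫ g)
      rw [← Category.assoc, h₁, F.map_comp]

variable [WeaklyLex C]

/-- The image of a pseudocongruence under a left covering functor is a congruence. -/
theorem PosFunctor.LeftCovering.isCongruence [Regular E] {F : PosFunctor C E}
    (hF : F.LeftCovering) (P : ExactCompletion C) {S : E} {p : F.obj P.R ⟶ S}
    {s₀ s₁ : S ⟶ F.obj P.X} (hp : IsSo p) (hp₀ : p ≫ s₀ = F.map P.r₀) (hp₁ : p ≫ s₁ = F.map P.r₁)
    (hs : ∀ (T : E) (s t : T ⟶ S), s ≫ s₀ ≤ t ≫ s₀ → s ≫ s₁ ≤ t ≫ s₁ → s ≤ t) :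
    IsCongruence s₀ s₁ := by
  have hrefl : ∀ {A : E} (x y : A ⟶ F.obj P.X), x ≤ y → Related s₀ s₁ x y := by
    intro A x y hxy
    obtain ⟨J, c₀, c₁, hw, hJ⟩ := exists_weakComma (𝟙 P.X) (𝟙 P.X)
    obtain ⟨K, k₀, k₁, hK⟩ := exists_comma (F.map (𝟙 P.X)) (F.map (𝟙 P.X))
    have e : F.map (𝟙 P.X) = 𝟙 _ := F.map_id _
    obtain ⟨t, ht₀, ht₁⟩ := hK.exists_lift (F.map c₀) (F.map c₁) (by
      rw [← F.map_comp, ← F.map_comp]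
      exact F.monotone_map hw)
    have ht : IsSo t := hF.comma hw hJ hK t ht₀ ht₁
    obtain ⟨n, hn₀, hn₁⟩ := hK.exists_lift x y (by rwa [e, Category.comp_id, Category.comp_id])
    obtain ⟨A', c, a, hc, ha⟩ := ht.exists_cover n
    obtain ⟨σ, hσ₀, hσ₁⟩ := P.order_reflexive c₀ c₁ (by simpa only [Category.comp_id] using hw)
    refine hc.exists_fill_pair hs (a ≫ F.map σ ≫ p) x y ?_ ?_
    · rw [← hn₀, ← Category.assoc c, ha]
      simp only [Category.assoc]
      rw [hp₀, ht₀, ← F.map_comp, hσ₀]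
    · rw [← hn₁, ← Category.assoc c, ha]
      simp only [Category.assoc]
      rw [hp₁, ht₁, ← F.map_comp, hσ₁]
  have htrans : ∀ {A : E} (x y z : A ⟶ F.obj P.X), Related s₀ s₁ x y → Related s₀ s₁ y z →
      Related s₀ s₁ x z := by
    rintro A x y z ⟨n, hn₀, hn₁⟩ ⟨m, hm₀, hm₁⟩
    obtain ⟨A₁, a₁, α, ha₁, hα⟩ := hp.exists_cover n
    obtain ⟨A₂, a₂, β, ha₂, hβ⟩ := hp.exists_cover (a₁ ≫ m)
    obtain ⟨Q, d₀, d₁, hQ⟩ := exists_weakPullback P.r₁ P.r₀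
    obtain ⟨τ, hτ₀, hτ₁⟩ := P.transitive d₀ d₁ hQ
    obtain ⟨K, k₀, k₁, hK⟩ := exists_pullback (F.map P.r₁) (F.map P.r₀)
    obtain ⟨t, ht₀, ht₁⟩ := hK.exists_lift (F.map d₀) (F.map d₁) (by
      rw [← F.map_comp, ← F.map_comp, hQ.w])
    have ht : IsSo t := hF.pullback hQ hK t ht₀ ht₁
    obtain ⟨γ, hγ₀, hγ₁⟩ := hK.exists_lift (a₂ ≫ α) β (by
      rw [← hp₀, ← hp₁, Category.assoc, ← Category.assoc α, ← hα, ← Category.assoc β, ← hβ]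
      simp only [Category.assoc]
      rw [hn₁, hm₀])
    obtain ⟨A₃, a₃, δ, ha₃, hδ⟩ := ht.exists_cover γ
    refine ((ha₃.comp ha₂).comp ha₁).exists_fill_pair hs (δ ≫ F.map τ ≫ p) x z ?_ ?_
    · calc (δ ≫ F.map τ ≫ p) ≫ s₀ = δ ≫ F.map (τ ≫ P.r₀) := by
            simp only [Category.assoc]; rw [hp₀, F.map_comp]
        _ = (δ ≫ t) ≫ k₀ ≫ p ≫ s₀ := by
            rw [hτ₀, F.map_comp, ← ht₀, hp₀]; simp only [Category.assoc]
        _ = a₃ ≫ a₂ ≫ (α ≫ p) ≫ s₀ := by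
            rw [← hδ, Category.assoc, ← Category.assoc γ, hγ₀]; simp only [Category.assoc]
        _ = ((a₃ ≫ a₂) ≫ a₁) ≫ x := by
            rw [← hα, ← hn₀]; simp only [Category.assoc]
    · calc (δ ≫ F.map τ ≫ p) ≫ s₁ = δ ≫ F.map (τ ≫ P.r₁) := by
            simp only [Category.assoc]; rw [hp₁, F.map_comp]
        _ = (δ ≫ t) ≫ k₁ ≫ p ≫ s₁ := by
            rw [hτ₁, F.map_comp, ← ht₁, hp₁]; simp only [Category.assoc]
        _ = a₃ ≫ (β ≫ p) ≫ s₁ := by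
            rw [← hδ, Category.assoc, ← Category.assoc γ, hγ₁]; simp only [Category.assoc]
        _ = ((a₃ ≫ a₂) ≫ a₁) ≫ z := by
            rw [← hβ, ← hm₁]; simp only [Category.assoc]
  exact ⟨fun s t => hs _ s t, fun x => hrefl x x le_rfl, htrans, fun x x' y y' h hx hy =>
    htrans _ _ _ (hrefl _ _ hx) (htrans _ _ _ h (hrefl _ _ hy))⟩

variable [Exact E]

/-- For a pseudocongruence `(X, R)`, the pair `(F r₀, F r₁)` has a coinserter. -/
theorem PosFunctor.LeftCovering.exists_coinserter {F : PosFunctor C E} (hF : F.LeftCovering)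
    (P : ExactCompletion C) :
    ∃ (Q : E) (q : F.obj P.X ⟶ Q), IsCoinserter (F.map P.r₀) (F.map P.r₁) q := by
  obtain ⟨W, w₀, w₁, hW, hW'⟩ := exists_product (F.obj P.X) (F.obj P.X)
  obtain ⟨n, hn₀, hn₁⟩ := hW _ (F.map P.r₀) (F.map P.r₁)
  obtain ⟨S, p, m, hp, hm, hpm⟩ := Regular.exists_factorization n
  have hp₀ : p ≫ m ≫ w₀ = F.map P.r₀ := by rw [← Category.assoc, hpm, hn₀]
  have hp₁ : p ≫ m ≫ w₁ = F.map P.r₁ := by rw [← Category.assoc, hpm, hn₁]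
  have hS : IsCongruence (m ≫ w₀) (m ≫ w₁) := by
    refine hF.isCongruence P hp hp₀ hp₁ fun T s t h₀ h₁ => hm _ _ (hW' _ _ _ ?_ ?_)
    · simpa only [Category.assoc] using h₀
    · simpa only [Category.assoc] using h₁
  obtain ⟨Y, f, hf⟩ := Exact.effective hS
  obtain ⟨Q, q, j, hq, hj, hqj⟩ := Regular.exists_factorization f
  have hK : IsComma (m ≫ w₀) (m ≫ w₁) q q := by
    refine ⟨hj _ _ ?_, fun a b h => hf.exists_lift a b ?_, hf.le_of_le⟩
    · have h := hf.w
      rw [← hqj] at h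
      simpa only [Category.assoc] using h
    · rw [← hqj, ← Category.assoc, ← Category.assoc]
      exact PosEnriched.comp_le_comp h le_rfl
  have hc := hq.isCoinserter hK
  refine ⟨Q, q, ?_, fun h k => hc.exists_desc h (hp.le_of_comp_le ?_), hc.le_of_le⟩
  · rw [← hp₀, ← hp₁, Category.assoc p, Category.assoc p]
    exact PosEnriched.comp_le_comp le_rfl hc.w
  · rwa [← Category.assoc p (m ≫ w₀) h, ← Category.assoc p (m ≫ w₁) h, hp₀, hp₁]

/-- The object `F̄(X, R)`: the coinserter of `(F r₀, F r₁)`. -/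
noncomputable def extensionObj (F : PosFunctor C E) (hF : F.LeftCovering)
    (P : ExactCompletion C) : E :=
  (hF.exists_coinserter P).choose

/-- The coinserter `q : F X ⟶ F̄(X, R)`. -/
noncomputable def extensionProj (F : PosFunctor C E) (hF : F.LeftCovering)
    (P : ExactCompletion C) : F.obj P.X ⟶ extensionObj F hF P :=
  (hF.exists_coinserter P).choose_spec.choose

theorem extensionProj_isCoinserter (F : PosFunctor C E) (hF : F.LeftCovering)
    (P : ExactCompletion C) :
    IsCoinserter (F.map P.r₀) (F.map P.r₁) (extensionProj F hF P) :=
  (hF.exists_coinserter P).choose_spec.choose_spec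

theorem exists_extensionMap (F : PosFunctor C E) (hF : F.LeftCovering) {P Q : ExactCompletion C}
    (φ : Representative P Q) :
    ∃ t : extensionObj F hF P ⟶ extensionObj F hF Q,
      extensionProj F hF P ≫ t = F.map φ.f ≫ extensionProj F hF Q := by
  apply (extensionProj_isCoinserter F hF P).exists_desc
  obtain ⟨f', h₀, h₁⟩ := φ.compatible
  rw [← Category.assoc, ← Category.assoc, ← F.map_comp, ← F.map_comp, ← h₀, ← h₁,
    F.map_comp, F.map_comp, Category.assoc, Category.assoc]
  exact PosEnriched.comp_le_comp le_rfl (extensionProj_isCoinserter F hF Q).w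

/-- The morphism `F̄[f]` induced between the coinserters by a representative `f`. -/
noncomputable def extensionMapRep (F : PosFunctor C E) (hF : F.LeftCovering)
    {P Q : ExactCompletion C} (φ : Representative P Q) :
    extensionObj F hF P ⟶ extensionObj F hF Q :=
  (exists_extensionMap F hF φ).choose

theorem extensionProj_comp_mapRep (F : PosFunctor C E) (hF : F.LeftCovering)
    {P Q : ExactCompletion C} (φ : Representative P Q) :
    extensionProj F hF P ≫ extensionMapRep F hF φ = F.map φ.f ≫ extensionProj F hF Q :=
  (exists_extensionMap F hF φ).choose_spec

theorem extensionMapRep_mono (F : PosFunctor C E) (hF : F.LeftCovering)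
    {P Q : ExactCompletion C} {φ ψ : Representative P Q} (h : φ ≤ ψ) :
    extensionMapRep F hF φ ≤ extensionMapRep F hF ψ := by
  apply (extensionProj_isCoinserter F hF P).le_of_le
  obtain ⟨σ, h₀, h₁⟩ := h
  rw [extensionProj_comp_mapRep, extensionProj_comp_mapRep, ← h₀, ← h₁, F.map_comp, F.map_comp,
    Category.assoc, Category.assoc]
  exact PosEnriched.comp_le_comp le_rfl (extensionProj_isCoinserter F hF Q).w

theorem extension_hom_ext (F : PosFunctor C E) (hF : F.LeftCovering)
    {P : ExactCompletion C} {Z : E} {s t : extensionObj F hF P ⟶ Z}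
    (h : extensionProj F hF P ≫ s = extensionProj F hF P ≫ t) : s = t :=
  le_antisymm ((extensionProj_isCoinserter F hF P).le_of_le _ _ h.le)
    ((extensionProj_isCoinserter F hF P).le_of_le _ _ h.ge)

/-- The extension `F̄ : C_ex → E` of a left covering functor `F : C → E` into an exact category:
`F̄(X, R)` is the coinserter `q_(X,R) : F X ⟶ F̄(X, R)` of `(F r₀, F r₁)`, and `F̄[f]` is the
unique morphism with `q_(X,R) ≫ F̄[f] = F f ≫ q_(Y,S)`. -/
noncomputable def extension (F : PosFunctor C E) (hF : F.LeftCovering) :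
    PosFunctor (ExactCompletion C) E where
  obj := extensionObj F hF
  map := Quotient.lift (fun φ => extensionMapRep F hF φ) (fun _ _ h =>
    le_antisymm (extensionMapRep_mono F hF h.1) (extensionMapRep_mono F hF h.2))
  map_id P := by
    change extensionMapRep F hF (Representative.id P) = _
    apply extension_hom_ext
    rw [extensionProj_comp_mapRep, Category.comp_id]
    exact (congrArg (· ≫ _) (F.map_id P.X)).trans (Category.id_comp _)
  map_comp := by
    rintro P Q T ⟨φ⟩ ⟨ψ⟩
    change extensionMapRep F hF (φ.comp ψ) = extensionMapRep F hF φ ≫ extensionMapRep F hF ψ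
    apply extension_hom_ext
    rw [extensionProj_comp_mapRep, ← Category.assoc, extensionProj_comp_mapRep, Category.assoc,
      extensionProj_comp_mapRep, ← Category.assoc]
    exact congrArg (· ≫ _) (F.map_comp φ.f ψ.f)
  monotone_map := by
    rintro P Q ⟨φ⟩ ⟨ψ⟩ h
    exact extensionMapRep_mono F hF (φ := φ) (ψ := ψ) h

end Extension

end PosCat

/-! Write `q : F X ⟶ F̄(X, R)` for the chosen coinserter. Everything rests on one reflection
principle: if `F x ≫ q ≤ F y ≫ q` for `x, y : A ⟶ X`, then `(x, y)` already factors through `(r₀,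
r₁)` in `C`.

It has two sources. First, exactness: the image `S` of `F R` in `F X × F X` is a congruence because
`F` is left covering, hence the kernel congruence of some `f`. Since `q` is the universal morphism
inserting `(F r₀, F r₁)`, `f` factors through `q`, and this forces `S` to be the kernel congruence
of `q` itself (`exists_kernel_cover`). Second, projectivity: the inequality gives a morphism `F A ⟶
S`, which lifts along the `so`-morphism `F R ⟶ S` to a morphism `F A ⟶ F R`. By fullness this lift
comes from `C`, and by faithfulness it witnesses the relation there (`related_of_related`).

The preorder `≼` on representatives is exactly such a relation, so `F̄` reflects the order. For
fullness, `q ≫ h` lifts along the `so`-morphism `q'` of the target to some `F f`, and the same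
principle shows that `f` respects the pseudocongruences.

For the second claim, cover `A` by `e : F X ⟶ A` and the kernel congruence of `e` by some `F R`. The
resulting pair `R ⇉ X` captures precisely the pairs with `F x ≫ e ≤ F y ≫ e`. This makes it a
pseudocongruence whose image has coinserter `e`, so that `A ≅ F̄(X, R)`. -/

namespace PosCat

/-! ### Enriched equivalences from full order-faithfulness -/

/-- A fully order-faithful functor which is essentially surjective is an equivalence of
poset-enriched categories. -/
theorem PosFunctor.FullyOrderFaithful.isEquivalence {C : Type u₁} [Category.{v₁} C] [PosEnriched C]
    {D : Type u₂} [Category.{v₂} D] [PosEnriched D] {F : PosFunctor C D}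
    (hF : F.FullyOrderFaithful) (hs : F.toFunctor.EssSurj) : F.IsEquivalence := by
  have hfull : F.toFunctor.Full := ⟨fun h => hF.full h⟩
  have hfaith : F.toFunctor.Faithful := ⟨fun {_ _ f g} h =>
    le_antisymm ((hF.map_le_map_iff f g).1 h.le) ((hF.map_le_map_iff g f).1 h.ge)⟩
  have heq : F.toFunctor.IsEquivalence := {}
  let e := F.toFunctor.asEquivalence
  refine ⟨⟨e.inverse, fun {X Y f g} h => ?_⟩, ⟨e.unitIso.symm⟩, ⟨e.counitIso⟩⟩
  -- Only local monotonicity of the ordinary inverse remains to be shown. Applying `F` to the image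
  -- of `k` gives `k` conjugated by the counit, which is monotone in `k`, and `F` reflects the
  -- order.
  have key : ∀ k : X ⟶ Y,
      F.map (e.inverse.map k) = e.counit.app X ≫ k ≫ e.counitInv.app Y := fun k =>
    e.fun_inv_map X Y k
  rw [← hF.map_le_map_iff, key, key]
  exact PosEnriched.comp_le_comp le_rfl (PosEnriched.comp_le_comp h le_rfl)

/-! ### Lifting relations from `E` to `C` by projectivity -/

section Lifting

variable {C : Type u₁} [Category.{v₁} C] [PosEnriched C]
variable {E : Type u₂} [Category.{v₂} E] [PosEnriched E]

/-- Along a fully order-faithful functor with `so`-projective values, relatedness by a relation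
covered by `F R` lifts to relatedness by the pair `(r₀, r₁)`. -/
theorem PosFunctor.FullyOrderFaithful.related_of_related {F : PosFunctor C E}
    (hff : F.FullyOrderFaithful) {A R X : C} (hA : SoProjective (F.obj A)) {r₀ r₁ : R ⟶ X} {S : E}
    {p : F.obj R ⟶ S} {s₀ s₁ : S ⟶ F.obj X} (hp : IsSo p) (hp₀ : p ≫ s₀ = F.map r₀)
    (hp₁ : p ≫ s₁ = F.map r₁) {x y : A ⟶ X} (h : Related s₀ s₁ (F.map x) (F.map y)) :
    Related r₀ r₁ x y := by
  have hinj : ∀ {f g : A ⟶ X}, F.map f = F.map g → f = g := fun {f g} h =>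
    le_antisymm ((hff.map_le_map_iff f g).1 h.le) ((hff.map_le_map_iff g f).1 h.ge)
  obtain ⟨n, hn₀, hn₁⟩ := h
  -- The witness `n` lands in `S`, which need not come from `C`. Projectivity moves it to `F R`,
  -- where fullness applies.
  obtain ⟨n', hn'⟩ := hA p hp n
  obtain ⟨σ, rfl⟩ := hff.full n'
  change F.map σ ≫ p = n at hn'
  refine ⟨σ, hinj ?_, hinj ?_⟩
  · rw [F.map_comp, ← hp₀, ← Category.assoc, hn', hn₀]
  · rw [F.map_comp, ← hp₁, ← Category.assoc, hn', hn₁]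

/-- If `e : F X ⟶ A` is an `so`-morphism, then covering the kernel congruence of `e` by some `F R`
yields a pseudocongruence in `C` with coinserter `e`. -/
theorem PosFunctor.FullyOrderFaithful.exists_pseudocongruence [Regular E]
    {F : PosFunctor C E} (hff : F.FullyOrderFaithful) (hproj : ∀ X : C, SoProjective (F.obj X))
    (hcov : ∀ A : E, ∃ (X : C) (e : F.obj X ⟶ A), IsSo e) (A : E) :
    ∃ (P : Pseudocongruence C) (e : F.obj P.X ⟶ A), IsCoinserter (F.map P.r₀) (F.map P.r₁) e := by
  obtain ⟨X, e, he⟩ := hcov A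
  obtain ⟨K, k₀, k₁, hK⟩ := exists_comma e e
  obtain ⟨R, p, hp⟩ := hcov K
  obtain ⟨r₀, hr₀⟩ := hff.full (p ≫ k₀)
  obtain ⟨r₁, hr₁⟩ := hff.full (p ≫ k₁)
  -- The condition `F x ≫ e ≤ F y ≫ e` is reflexive for the order and transitive, so reflecting it
  -- yields both pseudocongruence axioms at once.
  have hrel : ∀ {B : C} {x y : B ⟶ X}, F.map x ≫ e ≤ F.map y ≫ e → Related r₀ r₁ x y :=
    fun h => hff.related_of_related (hproj _) hp hr₀.symm hr₁.symm (hK.exists_lift _ _ h)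
  have hr : F.map r₀ ≫ e ≤ F.map r₁ ≫ e := by
    rw [hr₀, hr₁, Category.assoc, Category.assoc]
    exact PosEnriched.comp_le_comp le_rfl hK.w
  have hc := he.isCoinserter hK
  -- As `p` is an order-epimorphism, inserting `(F r₀, F r₁) = (p ≫ k₀, p ≫ k₁)` is the same as
  -- inserting `(k₀, k₁)`, whose coinserter is `e`.
  refine ⟨⟨X, R, r₀, r₁, fun a₀ a₁ h => hrel ?_, fun d₀ d₁ hd => hrel ?_⟩, e, hr,
    fun h hh => hc.exists_desc h (hp.le_of_comp_le ?_), hc.le_of_le⟩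
  · exact PosEnriched.comp_le_comp (F.monotone_map h) le_rfl
  -- The generic inequality `hr` is used along `d₀` and then along `d₁`. The two are joined by
  -- commutativity of the square; its weak universality plays no role.
  · calc F.map (d₀ ≫ r₀) ≫ e = F.map d₀ ≫ F.map r₀ ≫ e := by rw [F.map_comp, Category.assoc]
      _ ≤ F.map d₀ ≫ F.map r₁ ≫ e := PosEnriched.comp_le_comp le_rfl hr
      _ = F.map d₁ ≫ F.map r₀ ≫ e := by
        rw [← Category.assoc, ← F.map_comp, hd.w, F.map_comp, Category.assoc]
      _ ≤ F.map d₁ ≫ F.map r₁ ≫ e := PosEnriched.comp_le_comp le_rfl hr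
      _ = F.map (d₁ ≫ r₁) ≫ e := by rw [F.map_comp, Category.assoc]
  · rwa [← Category.assoc, ← Category.assoc, ← hr₀, ← hr₁]

/-! ### Kernel congruences of coinserters, and full order-faithfulness of the extension -/

variable [WeaklyLex C] [Exact E]

/-- The kernel congruence of any coinserter of `(F r₀, F r₁)` is covered by `F R`. -/
theorem PosFunctor.LeftCovering.exists_kernel_cover {F : PosFunctor C E} (hF : F.LeftCovering)
    (P : ExactCompletion C) {Q : E} {q : F.obj P.X ⟶ Q}
    (hq : IsCoinserter (F.map P.r₀) (F.map P.r₁) q) :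
    ∃ (S : E) (p : F.obj P.R ⟶ S) (s₀ s₁ : S ⟶ F.obj P.X), IsSo p ∧ p ≫ s₀ = F.map P.r₀ ∧
      p ≫ s₁ = F.map P.r₁ ∧ IsComma s₀ s₁ q q := by
  obtain ⟨W, w₀, w₁, hW, hW'⟩ := exists_product (F.obj P.X) (F.obj P.X)
  obtain ⟨n, hn₀, hn₁⟩ := hW _ (F.map P.r₀) (F.map P.r₁)
  -- `S` is the relation on `F X` generated as the image of `F R`; exactness below presents it as
  -- the kernel congruence of some `f`, not yet of `q`.
  obtain ⟨S, p, m, hp, hm, hpm⟩ := Regular.exists_factorization n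
  have hp₀ : p ≫ m ≫ w₀ = F.map P.r₀ := by rw [← Category.assoc, hpm, hn₀]
  have hp₁ : p ≫ m ≫ w₁ = F.map P.r₁ := by rw [← Category.assoc, hpm, hn₁]
  have hS : IsCongruence (m ≫ w₀) (m ≫ w₁) := by
    refine hF.isCongruence P hp hp₀ hp₁ fun T s t h₀ h₁ => hm _ _ (hW' _ _ _ ?_ ?_)
    · simpa only [Category.assoc] using h₀
    · simpa only [Category.assoc] using h₁
  obtain ⟨Y, f, hf⟩ := Exact.effective hS
  -- Containment of `S` in the kernel congruence of `q` is tested after `p`, where it is the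
  -- coinserter inequality.
  refine ⟨S, p, m ≫ w₀, m ≫ w₁, hp, hp₀, hp₁, hp.le_of_comp_le ?_, fun a b h => ?_, hf.le_of_le⟩
  · rw [← Category.assoc p (m ≫ w₀), ← Category.assoc p (m ≫ w₁), hp₀, hp₁]
    exact hq.w
  -- Conversely `f` inserts `(F r₀, F r₁)`, so it factors through `q`. Any pair ordered after `q` is
  -- then ordered after `f`, and so lies in `S`.
  · obtain ⟨t, rfl⟩ : ∃ t, q ≫ t = f := by
      apply hq.exists_desc
      rw [← hp₀, ← hp₁, Category.assoc p, Category.assoc p]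
      exact PosEnriched.comp_le_comp le_rfl hf.w
    refine hf.exists_lift a b ?_
    rw [← Category.assoc, ← Category.assoc]
    exact PosEnriched.comp_le_comp h le_rfl

/-- If `F` is fully order-faithful with `so`-projective values, then inequalities after the
coinserter `q_(X,R)` are witnessed by the pseudocongruence. -/
theorem related_of_comp_extensionProj_le (F : PosFunctor C E) (hF : F.LeftCovering)
    (hff : F.FullyOrderFaithful) {A : C} (hA : SoProjective (F.obj A)) (P : ExactCompletion C)
    {x y : A ⟶ P.X} (h : F.map x ≫ extensionProj F hF P ≤ F.map y ≫ extensionProj F hF P) :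
    Related P.r₀ P.r₁ x y := by
  obtain ⟨S, p, s₀, s₁, hp, hp₀, hp₁, hS⟩ :=
    hF.exists_kernel_cover P (extensionProj_isCoinserter F hF P)
  exact hff.related_of_related hA hp hp₀ hp₁ (hS.exists_lift _ _ h)

/-- Projectivity of `F X` supplies representatives and their order witnesses, while projectivity of
`F R` supplies their compatibility with the pseudocongruences. -/
theorem extension_fullyOrderFaithful (F : PosFunctor C E) (hF : F.LeftCovering)
    (hff : F.FullyOrderFaithful) (hproj : ∀ X : C, SoProjective (F.obj X)) :
    (extension F hF).FullyOrderFaithful where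
  full {P Q} h := by
    change extensionObj F hF P ⟶ extensionObj F hF Q at h
    have hq : IsSo (extensionProj F hF Q) :=
      IsEffectiveEpi.isSo ⟨_, _, _, extensionProj_isCoinserter F hF Q⟩
    -- A representative of `h` is a lift of `q ≫ h` along the coinserter of the target, which is an
    -- `so`-morphism because it is an effective epimorphism.
    obtain ⟨g, hg⟩ := hproj P.X _ hq (extensionProj F hF P ≫ h)
    obtain ⟨f, rfl⟩ := hff.full g
    change F.map f ≫ extensionProj F hF Q = _ at hg
    -- Compatibility is itself a relatedness statement, for generalized elements with domain `R`.
    -- Through `hg` its hypothesis becomes the coinserter inequality of the source composed with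
    -- `h`.
    have hf : Related Q.r₀ Q.r₁ (P.r₀ ≫ f) (P.r₁ ≫ f) := by
      apply related_of_comp_extensionProj_le F hF hff (hproj _)
      rw [F.map_comp, F.map_comp, Category.assoc, Category.assoc, hg, ← Category.assoc,
        ← Category.assoc]
      exact PosEnriched.comp_le_comp (extensionProj_isCoinserter F hF P).w le_rfl
    refine ⟨toAntisymmetrization _ (⟨f, hf⟩ : Representative P Q), ?_⟩
    change extensionMapRep F hF ⟨f, hf⟩ = h
    apply extension_hom_ext
    rw [extensionProj_comp_mapRep, hg]
  map_le_map_iff {P Q} := by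
    rintro ⟨φ⟩ ⟨ψ⟩
    refine ⟨fun h => ?_, (extension F hF).monotone_map⟩
    change extensionMapRep F hF φ ≤ extensionMapRep F hF ψ at h
    -- The order on classes unfolds on representatives to relatedness by the target
    -- pseudocongruence.
    change Related Q.r₀ Q.r₁ φ.f ψ.f
    apply related_of_comp_extensionProj_le F hF hff (hproj _)
    rw [← extensionProj_comp_mapRep, ← extensionProj_comp_mapRep]
    exact PosEnriched.comp_le_comp le_rfl h

end Lifting

/-! ### Uniqueness of coinserters and the main theorem -/

/-- Coinserters of the same pair are isomorphic. -/
theorem IsCoinserter.nonempty_iso {C : Type u} [Category.{v} C] [PosEnriched C] {X Y Q Q' : C}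
    {f g : X ⟶ Y} {q : Y ⟶ Q} {q' : Y ⟶ Q'} (h : IsCoinserter f g q) (h' : IsCoinserter f g q') :
    Nonempty (Q ≅ Q') := by
  obtain ⟨s, hs⟩ := h.exists_desc q' h'.w
  obtain ⟨t, ht⟩ := h'.exists_desc q h.w
  have hst : q ≫ s ≫ t = q ≫ 𝟙 _ := by rw [← Category.assoc, hs, ht, Category.comp_id]
  have hts : q' ≫ t ≫ s = q' ≫ 𝟙 _ := by rw [← Category.assoc, ht, hs, Category.comp_id]
  exact ⟨⟨s, t, le_antisymm (h.le_of_le _ _ hst.le) (h.le_of_le _ _ hst.ge),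
    le_antisymm (h'.le_of_le _ _ hts.le) (h'.le_of_le _ _ hts.ge)⟩⟩

end PosCat

/-- Let `F : C → E` be a left covering functor from a weakly lex to an exact category. If `F` is
fully order-faithful with `so`-projective values, then its extension `F̄ : C_ex → E` is
fully order-faithful; if
moreover every object of `E` is covered by an `so`-morphism from some `F X`, then `F̄` is an
equivalence. -/
theorem mainTheorem4 {C : Type u₁} [Category.{v₁} C] [PosCat.PosEnriched C] [PosCat.WeaklyLex C]
    {E : Type u₂} [Category.{v₂} E] [PosCat.PosEnriched E] [PosCat.Exact E]
    (F : PosCat.PosFunctor C E) (hF : F.LeftCovering)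
    (hff : F.FullyOrderFaithful) (hproj : ∀ X : C, PosCat.SoProjective (F.obj X)) :
    (PosCat.extension F hF).FullyOrderFaithful ∧
      ((∀ A : E, ∃ (X : C) (e : F.obj X ⟶ A), PosCat.IsSo e) →
        (PosCat.extension F hF).IsEquivalence) := by
  have h := PosCat.extension_fullyOrderFaithful F hF hff hproj
  refine ⟨h, fun hcov => h.isEquivalence ⟨fun A => ?_⟩⟩
  -- Essential surjectivity: both `A` and the value of the extension at `P` are coinserters of the
  -- image of the pair `P`.
  obtain ⟨P, e, he⟩ := hff.exists_pseudocongruence hproj hcov A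
  exact ⟨P, (PosCat.extensionProj_isCoinserter F hF P).nonempty_iso he⟩
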